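/- **Theorem.** Let $\{(x_i,y_i)\}_{i=1}^n$, $n\ge 1$, be training data with labels $y_i\in\{-1,+1\}$, and let $f(\theta;x)\in\mathbb{R}$ be a model with parameter $\theta\in\mathbb{R}^d$; write $f_i(\theta):=f(\theta;x_i)$. Assume that for every input $x$ the map $\theta\mapsto f(\theta;x)$ is $\mathcal{C}^2$ and $L$-homogeneous, i.e. $f(c\theta;x)=c^L f(\theta;x)$ for all $c>0$. Let $\bar\theta_{\mathrm{init}}\in\mathbb{R}^d$ satisfy $f(\bar\theta_{\mathrm{init}};x)=0$ for all $x$, and suppose that there is $h\in\mathbb{R}^d$ with $y_i\langle\nabla f_i(\bar\theta_{\mathrm{init}}),h\rangle>0$ for all $i$. Let $\lambda=\lambda(\alpha)>0$ be a function of $\alpha>0$ with $\lambda(\alpha)=\Theta(\alpha^{-p})$ as $\alpha\to+\infty$ for some constant $p>0$. Let $$\mathcal{L}_\lambda(\theta)=\frac1n\sum_{i=1}^n e^{-y_i f_i(\theta)}+\frac{\lambda}{2}\|\theta\|_2^2,$$ and let $\theta(t;\theta_0)$, $t\ge 0$, denote the gradient flow $\frac{d\theta}{dt}=-\nabla\mathcal{L}_{\lambda}(\theta)$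 with $\theta(0)=\theta_0$; for $\theta_0=\alpha\bar\theta_{\mathrm{init}}$ the weight decay is $\lambda=\lambda(\alpha)$. Then for every constant $c>0$ and every sequence of reals $\{\alpha_k\}_{k\ge1}$ with $\alpha_k\to+\infty$ there is a sequence of times $\{t_k\}_{k\ge1}$ such that $$\frac{1}{\lambda(\alpha_k)}\log\alpha_k\ \le\ t_k\ \le\ \frac{1+c}{\lambda(\alpha_k)}\log\alpha_k\qquad\text{for every } k \text{ with } \alpha_k\ge 1,$$ and every limit point of the sequence $$\frac{\theta(t_k;\alpha_k\bar\theta_{\mathrm{init}})}{\|\theta(t_k;\alpha_k\bar\theta_{\mathrm{init}})\|_2},\qquad k\ge 1,$$ is along the direction of a KKT point of the problem $$\min\ \tfrac12\|\theta\|_2^2\quad\text{s.t.}\quad y_i f_i(\theta)\ge 1\ \text{ for all } i\in\{1,\dots,n\},$$ that is, it equals $\theta^*/\|\theta^*\|_2$ for some nonzero $\theta^*$ with $y_if_i(\theta^*)\ge1$ for all $i$ for which there are $\mu_1,\dots,\mu_n\ge0$ with $\theta^*=\sum_i\mu_iy_i\nabla f_i(\theta^*)$ and $\mu_i(y_if_i(\theta^*)-1)=0$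 for all $i$. -/

import Mathlib

noncomputable section

/-- `θ` solves the gradient flow `dθ/dt = -∇F(θ)` on `[0, ∞)` with `θ(0) = θ₀`
(at `t = 0` the derivative is one-sided). -/
def IsGradientFlow {E : Type*} [NormedAddCommGroup E] [InnerProductSpace ℝ E] [CompleteSpace E]
    (F : E → ℝ) (θ₀ : E) (θ : ℝ → E) : Prop :=
  θ 0 = θ₀ ∧ ∀ t : ℝ, 0 ≤ t → HasDerivWithinAt θ (-gradient F (θ t)) (Set.Ici 0) t

open Classical in
/-- `gradientFlow F θ₀ t` is `θ(t; θ₀)`, the point reached at time `t ≥ 0` by gradient flow on `F`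
started at `θ₀`. (If there were no solution on `[0, ∞)`, it would be the constant `θ₀`.) -/
def gradientFlow {E : Type*} [NormedAddCommGroup E] [InnerProductSpace ℝ E] [CompleteSpace E]
    (F : E → ℝ) (θ₀ : E) : ℝ → E :=
  if h : ∃ θ : ℝ → E, IsGradientFlow F θ₀ θ then h.choose else fun _ => θ₀

/-- The exponential loss `ℓ(ŷ; y) = exp(-y ŷ)`. -/
def expLoss (yhat y : ℝ) : ℝ := Real.exp (-(y * yhat))

/-- The average training loss `(1/n) ∑ᵢ ℓ(f(θ; xᵢ); yᵢ)`. -/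
def trainLoss {E X : Type*} {n : ℕ} (f : E → X → ℝ) (x : Fin n → X) (y : Fin n → ℝ) (θ : E) : ℝ :=
  (1 / (n : ℝ)) * ∑ i, expLoss (f θ (x i)) (y i)

/-- The training loss with weight decay `lam`: `𝓛(θ) + (lam / 2) ‖θ‖²`. -/
def regLoss {E X : Type*} [Norm E] {n : ℕ} (f : E → X → ℝ) (x : Fin n → X) (y : Fin n → ℝ)
    (lam : ℝ) (θ : E) : ℝ :=
  trainLoss f x y θ + lam / 2 * ‖θ‖ ^ 2

/-- `θ` is a KKT point of the problem `min F(θ)` subject to `g i θ ≤ 0` for all `i`: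
feasibility, and multipliers `μ i ≥ 0` with stationarity and complementary slackness. -/
def IsKKTPoint {E ι : Type*} [NormedAddCommGroup E] [InnerProductSpace ℝ E] [CompleteSpace E]
    [Fintype ι] (F : E → ℝ) (g : ι → E → ℝ) (θ : E) : Prop :=
  (∀ i, g i θ ≤ 0) ∧
    ∃ μ : ι → ℝ, (∀ i, 0 ≤ μ i) ∧ gradient F θ + ∑ i, μ i • gradient (g i) θ = 0 ∧
      ∀ i, μ i * g i θ = 0

/-- `θ` is a KKT point of the max-margin problem
`min ½ ‖θ‖²` subject to `yᵢ f(θ; xᵢ) ≥ 1` for all `i`. -/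
def IsMaxMarginKKTPoint {E X : Type*} [NormedAddCommGroup E] [InnerProductSpace ℝ E]
    [CompleteSpace E] {n : ℕ} (f : E → X → ℝ) (x : Fin n → X) (y : Fin n → ℝ) (θ : E) : Prop :=
  IsKKTPoint (fun w : E => 1 / 2 * ‖w‖ ^ 2) (fun (i : Fin n) (w : E) => 1 - y i * f w (x i)) θ

end

/-! Write `g i` for the margins, `a` for the initial scale and `Λ = log a`. Weight decay alone would
shrink the start to `a e^{-λt} θ₀`, so consider `ψ = θ / (a e^{-λt})`, which moves only through the
loss. Near `θ₀` the margins are almost linear, and at a point `ψ'` slightly along the common ascent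
direction they are positive. Hence `⟪∇g i ψ, ψ - ψ'⟫ ≤ g i ψ - b` on a ball around `ψ'` containing
`θ₀` (`exists_inner_gradient_sub_le`). This makes `‖ψ - ψ'‖² / 2` an almost decreasing potential,
whose decay rate controls the risk. A mean value argument on a window of length `1/λ`, ending when
the scale has dropped to order `Λ^{1/L}`, yields a regularized risk of order `λ Λ^{2/L}` before time
`Λ/λ` (`eventually_exists_regExpRisk_le`).

The regularized risk never increases, so this bound persists. As `λ` decays polynomially in `a`, it
forces margins of at least `(p/2) Λ` and norms of exact order `Λ^{1/L}`
(`eventually_margin_norm_bounds`). On the window from `Λ/λ` to `(1+c)Λ/λ` the remaining energy is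
too small for a large gradient throughout: at some time `‖∇‖ / (λ‖θ‖) = O(Λ^{-1/2})`
(`eventually_exists_almost_stationary`).

Such approximate stationarity says that the direction is nearly a nonnegative combination of the `∇g
i`. Euler's identity bounds the coefficients, and the exponential tail kills those with non-minimal
limiting margin, so every limit direction is KKT (`exists_kkt_of_tendsto_direction`). -/

section

open Set Filter Topology

/-! ### Global existence and energy dissipation for gradient flow -/

section ODE

variable {E : Type*} [NormedAddCommGroup E]

/-- A bounded Lipschitz autonomous vector field has a forward integral curve defined for all
nonnegative times. -/
theorem exists_forward_integralCurve_of_lipschitz_of_bounded [NormedSpace ℝ E] [CompleteSpace E]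
    {v : E → E} {K M : NNReal} (hv : LipschitzWith K v) (hM : ∀ w, ‖v w‖ ≤ M) (x₀ : E) :
    ∃ γ : ℝ → E, γ 0 = x₀ ∧ ∀ t, 0 ≤ t → HasDerivWithinAt γ (v (γ t)) (Ici 0) t := by
  have key : ∀ T : ℝ, 0 ≤ T → ∃ γ : ℝ → E, γ 0 = x₀ ∧
      ∀ t ∈ Icc 0 T, HasDerivWithinAt γ (v (γ t)) (Icc 0 T) t := by
    intro T hT
    -- The field is bounded by `M` everywhere, so a ball of radius `M * T` lets Picard–Lindelöf
    -- reach any `T` in one step.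
    have hPL : IsPicardLindelof (fun _ : ℝ => v) (⟨0, le_rfl, hT⟩ : Icc (0 : ℝ) T) x₀
        (M * T.toNNReal) 0 M K :=
      { lipschitzOnWith := fun _ _ => hv.lipschitzOnWith
        continuousOn := fun _ _ => continuousOn_const
        norm_le := fun _ _ w _ => hM w
        mul_max_le := by simp [hT] }
    exact hPL.exists_eq_forall_mem_Icc_hasDerivWithinAt₀
  choose! γ hγ0 hγ using key
  have huniq : ∀ S T : ℝ, 0 ≤ S → S ≤ T → EqOn (γ S) (γ T) (Icc 0 S) := by
    intro S T hS hST
    have hT := hS.trans hST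
    have hsub : Icc 0 S ⊆ Icc 0 T := Icc_subset_Icc_right hST
    have hright : ∀ R : ℝ, ∀ t ∈ Ico 0 R, Icc 0 R ∈ 𝓝[Ici t] t := fun R t ht =>
      mem_of_superset (Icc_mem_nhdsGE ht.2) (Icc_subset_Icc_left ht.1)
    refine ODE_solution_unique (v := fun _ => v) (fun _ => hv)
      (fun t ht => (hγ S hS t ht).continuousWithinAt) (fun t ht => ?_)
      (fun t ht => ((hγ T hT t (hsub ht)).mono hsub).continuousWithinAt) (fun t ht => ?_)
      ((hγ0 S hS).trans (hγ0 T hT).symm)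
    · exact (hγ S hS t (Ico_subset_Icc_self ht)).mono_of_mem_nhdsWithin (hright S t ht)
    · exact (hγ T hT t (hsub (Ico_subset_Icc_self ht))).mono_of_mem_nhdsWithin
        (hright T t ⟨ht.1, ht.2.trans_le hST⟩)
  -- At time `t` the solution on `[0, t + 1]` is used, so that `t` is never the right endpoint;
  -- uniqueness makes the choices agree.
  refine ⟨fun t => γ (t + 1) t, by simpa using hγ0 1 zero_le_one, fun t ht => ?_⟩
  have h1 : (0 : ℝ) ≤ t + 1 := by linarith
  have hmem : Icc 0 (t + 1) ∈ 𝓝[Ici 0] t := by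
    have : Iic (t + 1) ∈ 𝓝 t := Iic_mem_nhds (by linarith)
    exact inter_mem_nhdsWithin (Ici 0) this
  have hd : HasDerivWithinAt (γ (t + 1)) (v (γ (t + 1) t)) (Ici 0) t :=
    (hγ (t + 1) h1 t ⟨ht, by linarith⟩).mono_of_mem_nhdsWithin hmem
  refine hd.congr_of_eventuallyEq ?_ rfl
  filter_upwards [hmem] with s hs
  have hs1 : 0 ≤ s + 1 := by linarith [hs.1]
  rcases le_total s t with h | h
  · exact huniq (s + 1) (t + 1) hs1 (by linarith) ⟨hs.1, by linarith⟩
  · exact (huniq (t + 1) (s + 1) h1 (by linarith) hs).symm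

variable [InnerProductSpace ℝ E] [CompleteSpace E]

theorem ContDiff.gradient_one {F : E → ℝ} (hF : ContDiff ℝ 2 F) : ContDiff ℝ 1 (gradient F) :=
  (InnerProductSpace.toDual ℝ E).symm.contDiff.comp (hF.fderiv_right (by norm_num))

theorem hasDerivWithinAt_comp_inner_gradient {F : E → ℝ} {γ : ℝ → E} {w : E} {s : Set ℝ} {t : ℝ}
    (hF : DifferentiableAt ℝ F (γ t)) (hγ : HasDerivWithinAt γ w s t) :
    HasDerivWithinAt (fun r => F (γ r)) (inner ℝ (gradient F (γ t)) w) s t := by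
  rw [inner_gradient_left]
  exact hF.hasFDerivAt.comp_hasDerivWithinAt t hγ

theorem antitoneOn_Ici_of_hasDerivWithinAt_nonpos {g g' : ℝ → ℝ}
    (hg : ∀ t, 0 ≤ t → HasDerivWithinAt g (g' t) (Ici 0) t) (hg' : ∀ t, 0 ≤ t → g' t ≤ 0) :
    AntitoneOn g (Ici 0) := by
  refine antitoneOn_of_hasDerivWithinAt_nonpos (convex_Ici 0)
    (fun t ht => (hg t ht).continuousWithinAt)
    (fun t ht => (hg t (interior_subset ht)).mono interior_subset)
    (fun t ht => hg' t (interior_subset ht))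

/-- Gradient flow of a `C²` function exists for all times when started in a bounded
sublevel set. -/
theorem exists_isGradientFlow_of_isBounded_sublevel [FiniteDimensional ℝ E] {F : E → ℝ}
    (hF : ContDiff ℝ 2 F) (θ₀ : E) (hb : Bornology.IsBounded {w | F w ≤ F θ₀}) :
    ∃ θ : ℝ → E, IsGradientFlow F θ₀ θ := by
  obtain ⟨R, hR0, hR⟩ := hb.subset_closedBall_lt 0 0
  -- The cut-off flow still decreases `F`, so it stays in the sublevel set, where the cutoff equals
  -- `1`: it solves the original equation.
  let φ : ContDiffBump (0 : E) := ⟨R, R + 1, hR0, by linarith⟩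
  have hv1 : ContDiff ℝ 1 (fun w => -(φ w • gradient F w)) :=
    (φ.contDiff.smul hF.gradient_one).neg
  have hcs : HasCompactSupport (fun w => -(φ w • gradient F w)) := by
    have := (φ.hasCompactSupport.smul_right (f' := gradient F)).comp_left (g := fun w => -w) neg_zero
    exact this
  obtain ⟨K, hK⟩ := hv1.lipschitzWith_of_hasCompactSupport hcs one_ne_zero
  obtain ⟨M, hM⟩ := hcs.exists_bound_of_continuous hv1.continuous
  obtain ⟨γ, hγ0, hγ⟩ := exists_forward_integralCurve_of_lipschitz_of_bounded hK (M := M.toNNReal)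
    (fun w => (hM w).trans (Real.le_coe_toNNReal M)) θ₀
  have hdiff : Differentiable ℝ F := hF.differentiable (by norm_num)
  have hanti : AntitoneOn (fun t => F (γ t)) (Ici 0) := by
    refine antitoneOn_Ici_of_hasDerivWithinAt_nonpos
      (fun t ht => hasDerivWithinAt_comp_inner_gradient (hdiff _) (hγ t ht)) (fun t _ => ?_)
    rw [inner_neg_right, inner_smul_right]
    have := mul_nonneg (φ.nonneg (x := γ t)) (real_inner_self_nonneg (x := gradient F (γ t)))
    linarith
  refine ⟨γ, hγ0, fun t ht => ?_⟩
  have hle : F (γ t) ≤ F θ₀ := by simpa [hγ0] using hanti self_mem_Ici ht ht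
  have hφ : φ (γ t) = 1 := φ.one_of_mem_closedBall (hR hle)
  simpa [hφ] using hγ t ht

/-- The later estimates hold for an arbitrary solution, so uniqueness of the chosen one plays no
role. -/
theorem isGradientFlow_gradientFlow {F : E → ℝ} {θ₀ : E}
    (h : ∃ θ : ℝ → E, IsGradientFlow F θ₀ θ) : IsGradientFlow F θ₀ (gradientFlow F θ₀) := by
  rw [gradientFlow, dif_pos h]
  exact h.choose_spec

namespace IsGradientFlow

variable {F : E → ℝ} {θ₀ : E} {θ : ℝ → E}

theorem hasDerivWithinAt_comp (h : IsGradientFlow F θ₀ θ) (hF : Differentiable ℝ F) {t : ℝ}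
    (ht : 0 ≤ t) :
    HasDerivWithinAt (fun r => F (θ r)) (-‖gradient F (θ t)‖ ^ 2) (Ici 0) t := by
  have := hasDerivWithinAt_comp_inner_gradient (hF _) (h.2 t ht)
  rwa [inner_neg_right, real_inner_self_eq_norm_sq] at this

theorem antitoneOn (h : IsGradientFlow F θ₀ θ) (hF : Differentiable ℝ F) :
    AntitoneOn (fun t => F (θ t)) (Ici 0) :=
  antitoneOn_Ici_of_hasDerivWithinAt_nonpos (fun _ ht => h.hasDerivWithinAt_comp hF ht)
    (fun _ _ => by simp)

/-- On every time interval some gradient norm is controlled by the average decrease. -/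
theorem exists_norm_gradient_sq_mul_le (h : IsGradientFlow F θ₀ θ) (hF : Differentiable ℝ F)
    {a b : ℝ} (ha : 0 ≤ a) (hab : a < b) :
    ∃ t ∈ Ioo a b, ‖gradient F (θ t)‖ ^ 2 * (b - a) = F (θ a) - F (θ b) := by
  have hsub : Icc a b ⊆ Ici 0 := fun s hs => ha.trans hs.1
  obtain ⟨t, ht, hslope⟩ := exists_hasDerivAt_eq_slope (fun r => F (θ r))
    (fun r => -‖gradient F (θ r)‖ ^ 2) hab
    (fun s hs => ((h.hasDerivWithinAt_comp hF (hsub hs)).mono hsub).continuousWithinAt)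
    (fun s hs => (h.hasDerivWithinAt_comp hF (ha.trans hs.1.le)).hasDerivAt
      (Ici_mem_nhds (ha.trans_lt hs.1)))
  refine ⟨t, ht, ?_⟩
  rw [eq_div_iff (by linarith)] at hslope
  linarith

end IsGradientFlow

end ODE

/-! ### Positively homogeneous functions -/

section Homogeneous

variable {E : Type*} [NormedAddCommGroup E] [InnerProductSpace ℝ E]

/-- `g` is positively homogeneous of degree `L`. -/
def IsPosHomogeneous (L : ℝ) (g : E → ℝ) : Prop :=
  ∀ c : ℝ, 0 < c → ∀ θ, g (c • θ) = c ^ L * g θ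

namespace IsPosHomogeneous

variable {L : ℝ} {g : E → ℝ}

theorem const_mul (hg : IsPosHomogeneous L g) (a : ℝ) :
    IsPosHomogeneous L (fun θ => a * g θ) := fun c hc θ => by
  simp only [hg c hc θ]; ring

/-- A continuous positively homogeneous function that vanishes somewhere but not everywhere has
positive degree. -/
theorem degree_pos (hg : IsPosHomogeneous L g) (hc : Continuous g) {θ₀ θ₁ : E} (h₀ : g θ₀ = 0)
    (h₁ : g θ₁ ≠ 0) : 0 < L := by
  have hlim : ∀ θ, Tendsto (fun c : ℝ => c ^ L * g θ) (𝓝[>] 0) (𝓝 (g 0)) := by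
    intro θ
    have h : Tendsto (fun c : ℝ => g (c • θ)) (𝓝[>] 0) (𝓝 (g 0)) := by
      have : Continuous fun c : ℝ => g (c • θ) := by fun_prop
      simpa using (this.tendsto 0).mono_left nhdsWithin_le_nhds
    refine h.congr' ?_
    filter_upwards [self_mem_nhdsWithin] with c hc using hg c hc θ
  have hg0 : g 0 = 0 := by
    have := hlim θ₀
    simp only [h₀, mul_zero] at this
    exact tendsto_nhds_unique this tendsto_const_nhds
  -- With `L ≤ 0`, shrinking `θ₁` towards the origin cannot decrease `|g|`, contradicting `g 0 = 0`.
  by_contra! hL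
  have hlow : ∀ᶠ c : ℝ in 𝓝[>] 0, |g θ₁| ≤ |c ^ L * g θ₁| := by
    filter_upwards [Ioo_mem_nhdsGT (zero_lt_one (α := ℝ))] with c hc
    rw [abs_mul, abs_of_pos (Real.rpow_pos_of_pos hc.1 L)]
    exact le_mul_of_one_le_left (abs_nonneg _)
      (Real.one_le_rpow_of_pos_of_le_one_of_nonpos hc.1 hc.2.le hL)
  have := ge_of_tendsto (hlim θ₁).abs hlow
  rw [hg0, abs_zero] at this
  exact h₁ (abs_nonpos_iff.1 this)

variable [CompleteSpace E]

theorem gradient_smul (hg : IsPosHomogeneous L g) (hd : Differentiable ℝ g) {c : ℝ} (hc : 0 < c)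
    (θ : E) : gradient g (c • θ) = c ^ (L - 1) • gradient g θ := by
  refine ext_inner_right ℝ fun w => ?_
  rw [inner_smul_left, inner_gradient_left, inner_gradient_left]
  have h1 : HasFDerivAt (fun θ => g (c • θ)) ((fderiv ℝ g (c • θ)).comp
      (c • ContinuousLinearMap.id ℝ E)) θ :=
    (hd (c • θ)).hasFDerivAt.comp θ ((hasFDerivAt_id θ).const_smul c)
  have h2 : HasFDerivAt (fun θ => g (c • θ)) (c ^ L • fderiv ℝ g θ) θ := by
    have : (fun θ => g (c • θ)) = fun θ => c ^ L * g θ := funext (hg c hc)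
    rw [this]
    exact (hd θ).hasFDerivAt.const_mul _
  have h3 := congrArg (fun T : E →L[ℝ] ℝ => T w) (h1.unique h2)
  simp only [ContinuousLinearMap.comp_apply, FunLike.coe_smul, Pi.smul_apply,
    ContinuousLinearMap.id_apply, map_smul, smul_eq_mul] at h3
  rw [Real.rpow_sub_one hc.ne']
  simp only [conj_trivial]
  field_simp
  linarith

/-- Euler's identity. -/
theorem inner_gradient_self (hg : IsPosHomogeneous L g) (hd : Differentiable ℝ g) (θ : E) :
    inner ℝ (gradient g θ) θ = L * g θ := by
  have h1 : HasDerivAt (fun c : ℝ => g (c • θ)) (fderiv ℝ g θ θ) 1 := by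
    have h : HasDerivAt (fun c : ℝ => c • θ) θ 1 := by
      simpa using (hasDerivAt_id (1 : ℝ)).smul_const θ
    have h' : HasFDerivAt g (fderiv ℝ g θ) ((1 : ℝ) • θ) := by
      rw [one_smul]; exact (hd θ).hasFDerivAt
    exact h'.comp_hasDerivAt 1 h
  have h2 : HasDerivAt (fun c : ℝ => g (c • θ)) (L * g θ) 1 := by
    have h := (Real.hasDerivAt_rpow_const (x := 1) (p := L) (Or.inl one_ne_zero)).mul_const (g θ)
    rw [Real.one_rpow, mul_one] at h
    refine h.congr_of_eventuallyEq ?_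
    filter_upwards [lt_mem_nhds (zero_lt_one (α := ℝ))] with c hc using hg c hc θ
  rw [inner_gradient_left, h1.unique h2]

end IsPosHomogeneous

end Homogeneous

/-! ### The exponential risk with weight decay -/

section Risk

variable {E : Type*} {n : ℕ}

/-- The average exponential loss of the margins `g i`. -/
noncomputable def expRisk (g : Fin n → E → ℝ) (θ : E) : ℝ := (1 / (n : ℝ)) * ∑ i, Real.exp (-g i θ)

/-- The average exponential loss of the margins `g i` with weight decay `lam`. -/
noncomputable def regExpRisk [Norm E] (g : Fin n → E → ℝ) (lam : ℝ) (θ : E) : ℝ := expRisk g θ + lam / 2 * ‖θ‖ ^ 2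

theorem expRisk_nonneg (g : Fin n → E → ℝ) (θ : E) : 0 ≤ expRisk g θ := by
  unfold expRisk; positivity

theorem exp_neg_le_expRisk (hn : 0 < n) (g : Fin n → E → ℝ) (θ : E) (i : Fin n) :
    Real.exp (-g i θ) ≤ n * expRisk g θ := by
  have hn' : (n : ℝ) ≠ 0 := by positivity
  unfold expRisk
  rw [← mul_assoc, mul_one_div_cancel hn', one_mul]
  exact Finset.single_le_sum (f := fun i => Real.exp (-g i θ)) (fun _ _ => (Real.exp_pos _).le)
    (Finset.mem_univ i)

variable [NormedAddCommGroup E] [InnerProductSpace ℝ E]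

theorem contDiff_regExpRisk {g : Fin n → E → ℝ} (hg : ∀ i, ContDiff ℝ 2 (g i)) (lam : ℝ) :
    ContDiff ℝ 2 (regExpRisk g lam) := by
  unfold regExpRisk expRisk
  refine (contDiff_const.mul (ContDiff.sum fun i _ => (hg i).neg.exp)).add
    (contDiff_const.mul (contDiff_norm_sq ℝ))

theorem gradient_regExpRisk [CompleteSpace E] {g : Fin n → E → ℝ}
    (hg : ∀ i, Differentiable ℝ (g i)) (lam : ℝ) (θ : E) :
    gradient (regExpRisk g lam) θ =
      lam • θ - (1 / (n : ℝ)) • ∑ i, Real.exp (-g i θ) • gradient (g i) θ := by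
  apply HasGradientAt.gradient
  rw [hasGradientAt_iff_hasFDerivAt]
  have h1 : HasFDerivAt (fun w => (1 / (n : ℝ)) * ∑ i, Real.exp (-g i w))
      ((1 / (n : ℝ)) • ∑ i, Real.exp (-g i θ) • -fderiv ℝ (g i) θ) θ :=
    (HasFDerivAt.fun_sum fun i _ => (hg i θ).hasFDerivAt.neg.exp).const_mul _
  have h2 : HasFDerivAt (fun w : E => lam / 2 * ‖w‖ ^ 2)
      ((lam / 2) • (2 • (innerSL ℝ θ))) θ :=
    (hasStrictFDerivAt_norm_sq θ).hasFDerivAt.const_mul _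
  refine (h1.add h2).congr_fderiv ?_
  ext w
  simp only [smul_neg, Finset.sum_neg_distrib, add_apply,
    neg_apply, FunLike.coe_smul, Pi.smul_apply, map_sub, map_smul, map_sum,
    sub_apply, sum_apply, smul_eq_mul,
    InnerProductSpace.toDual_apply_apply, toDual_gradient, innerSL_apply_apply, two_nsmul]
  ring

/-- The risk is nonnegative, so weight decay alone makes the sublevel sets bounded. -/
theorem exists_isGradientFlow_regExpRisk [FiniteDimensional ℝ E] [CompleteSpace E]
    {g : Fin n → E → ℝ} (hg : ∀ i, ContDiff ℝ 2 (g i)) {lam : ℝ} (hlam : 0 < lam) (θ₀ : E) :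
    ∃ θ : ℝ → E, IsGradientFlow (regExpRisk g lam) θ₀ θ := by
  refine exists_isGradientFlow_of_isBounded_sublevel (contDiff_regExpRisk hg lam) θ₀ ?_
  rw [isBounded_iff_forall_norm_le]
  refine ⟨√(regExpRisk g lam θ₀ / (lam / 2)), fun w hw => Real.le_sqrt_of_sq_le ?_⟩
  rw [le_div_iff₀ (by positivity)]
  have : regExpRisk g lam w ≤ regExpRisk g lam θ₀ := hw
  have h0 := expRisk_nonneg g w
  unfold regExpRisk at this ⊢
  linarith

end Risk

/-! ### Approximate stationarity implies KKT in the limit -/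

section KKT

variable {E : Type*} [NormedAddCommGroup E] [InnerProductSpace ℝ E] [CompleteSpace E] {n : ℕ}

/-- Along an ultrafilter, the directions of approximate stationary points of the regularized
exponential risk whose norms tend to infinity, with normalized margins bounded below, converge
to the direction of a max-margin KKT point. -/
theorem exists_kkt_of_tendsto_direction (hn : 0 < n) {L : ℝ} (hL : 0 < L) {g : Fin n → E → ℝ}
    (hom : ∀ i, IsPosHomogeneous L (g i)) (hg : ∀ i, ContDiff ℝ 2 (g i)) {κ : Type*}
    (U : Ultrafilter κ) {θ : κ → E} {lam : κ → ℝ} {v : E} {γ : ℝ} (hγ : 0 < γ)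
    (hv : Tendsto (fun k => ‖θ k‖⁻¹ • θ k) U (𝓝 v))
    (hlam : ∀ᶠ k in (U : Filter κ), 0 < lam k)
    (hnorm : Tendsto (fun k => ‖θ k‖) U atTop)
    (hmargin : ∀ᶠ k in (U : Filter κ), ∀ i, γ * ‖θ k‖ ^ L ≤ g i (θ k))
    (hgrad : Tendsto (fun k => ‖gradient (regExpRisk g (lam k)) (θ k)‖ / (lam k * ‖θ k‖)) U
      (𝓝 0)) :
    ‖v‖ = 1 ∧ ∃ s : ℝ, 0 < s ∧ (∀ i, 1 ≤ g i (s • v)) ∧ ∃ μ : Fin n → ℝ, (∀ i, 0 ≤ μ i) ∧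
      s • v = ∑ i, μ i • gradient (g i) (s • v) ∧ ∀ i, μ i * (g i (s • v) - 1) = 0 := by
  have hd : ∀ i, Differentiable ℝ (g i) := fun i => (hg i).differentiable (by norm_num)
  set u : κ → E := fun k => ‖θ k‖⁻¹ • θ k with hu
  have hpos : ∀ᶠ k in (U : Filter κ), 0 < ‖θ k‖ := hnorm.eventually_gt_atTop 0
  have hunorm : ∀ᶠ k in (U : Filter κ), ‖u k‖ = 1 := by
    filter_upwards [hpos] with k hk
    rw [hu, norm_smul, norm_inv, norm_norm, inv_mul_cancel₀ hk.ne']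
  have hv1 : ‖v‖ = 1 := tendsto_nhds_unique hv.norm
    (tendsto_const_nhds.congr' (hunorm.mono fun k hk => hk.symm))
  have hθu : ∀ᶠ k in (U : Filter κ), θ k = ‖θ k‖ • u k := by
    filter_upwards [hpos] with k hk
    rw [hu, smul_smul, mul_inv_cancel₀ hk.ne', one_smul]
  have hgu : ∀ᶠ k in (U : Filter κ), ∀ i, g i (θ k) = ‖θ k‖ ^ L * g i (u k) := by
    filter_upwards [hpos, hθu] with k hk hk' i
    conv_lhs => rw [hk']
    exact hom i _ hk _
  have hmu : ∀ᶠ k in (U : Filter κ), ∀ i, γ ≤ g i (u k) := by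
    filter_upwards [hpos, hgu, hmargin] with k hk h1 h2 i
    have h3 := h2 i
    rw [h1 i, mul_comm] at h3
    exact le_of_mul_le_mul_left h3 (Real.rpow_pos_of_pos hk L)
  have hlimg : ∀ i, Tendsto (fun k => g i (u k)) U (𝓝 (g i v)) := fun i =>
    ((hg i).continuous.tendsto v).comp hv
  have hγv : ∀ i, γ ≤ g i v := fun i => ge_of_tendsto (hlimg i) (hmu.mono fun k hk => hk i)
  -- These are the coefficients of the `∇g i (u k)` after dividing the full gradient by `lam k * ‖θ
  -- k‖`; the residual `r` below then tends to `0`.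
  set m : Fin n → κ → ℝ := fun i k =>
    1 / (n : ℝ) * Real.exp (-g i (θ k)) * ‖θ k‖ ^ (L - 1) / (lam k * ‖θ k‖) with hm
  have hm0 : ∀ᶠ k in (U : Filter κ), ∀ i, 0 ≤ m i k := by
    filter_upwards [hlam] with k hk i
    simp only [hm]; positivity
  set r : κ → E := fun k => u k - ∑ i, m i k • gradient (g i) (u k) with hr
  have hreq : ∀ᶠ k in (U : Filter κ),
      r k = (lam k * ‖θ k‖)⁻¹ • gradient (regExpRisk g (lam k)) (θ k) := by
    filter_upwards [hpos, hlam, hθu] with k hk hlk hk'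
    have hgr : ∀ i, gradient (g i) (θ k) = ‖θ k‖ ^ (L - 1) • gradient (g i) (u k) := by
      intro i
      conv_lhs => rw [hk']
      exact (hom i).gradient_smul (hd i) hk _
    rw [gradient_regExpRisk hd, smul_sub, smul_smul]
    simp only [hr, hgr, Finset.smul_sum, smul_smul]
    congr 1
    · simp only [hu]
      congr 1
      field_simp
    · refine Finset.sum_congr rfl fun i _ => ?_
      congr 1
      simp only [hm]
      ring
  have hr0 : Tendsto r U (𝓝 0) := by
    rw [tendsto_zero_iff_norm_tendsto_zero]
    refine hgrad.congr' ?_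
    filter_upwards [hreq, hpos, hlam] with k hk h1 h2
    rw [hk, norm_smul, norm_inv, Real.norm_of_nonneg (by positivity), div_eq_inv_mul]
  -- Pairing `r` with `u` gives `1 - L ∑ m j * g j u ≥ -1` by Euler's identity. All summands are
  -- nonnegative, so each satisfies `m i * (L * γ) ≤ 2`.
  have hmle : ∀ᶠ k in (U : Filter κ), ∀ i, m i k ∈ Icc 0 (2 / (L * γ)) := by
    have hr1 : ∀ᶠ k in (U : Filter κ), ‖r k‖ < 1 :=
      (tendsto_zero_iff_norm_tendsto_zero.1 hr0).eventually_lt_const zero_lt_one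
    filter_upwards [hm0, hr1, hunorm, hmu] with k hk h1 h2 h3 i
    refine ⟨hk i, ?_⟩
    have hin : inner ℝ (r k) (u k) = 1 - ∑ j, m j k * (L * g j (u k)) := by
      simp only [hr, inner_sub_left, sum_inner, inner_smul_left, real_inner_self_eq_norm_sq, h2,
        (hom _).inner_gradient_self (hd _), conj_trivial, one_pow]
    have habs := abs_real_inner_le_norm (r k) (u k)
    rw [h2, mul_one, hin] at habs
    have hle := (abs_le.1 (habs.trans h1.le)).1
    have hsum : m i k * (L * γ) ≤ ∑ j, m j k * (L * g j (u k)) := by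
      refine (mul_le_mul_of_nonneg_left (mul_le_mul_of_nonneg_left (h3 i) hL.le) (hk i)).trans ?_
      refine Finset.single_le_sum (f := fun j => m j k * (L * g j (u k))) (fun j _ => ?_)
        (Finset.mem_univ i)
      exact mul_nonneg (hk j) (mul_nonneg hL.le (hγ.le.trans (h3 j)))
    rw [le_div_iff₀ (by positivity)]
    linarith
  have hlimm : ∀ i, ∃ a ∈ Icc 0 (2 / (L * γ)), Tendsto (m i) U (𝓝 a) := fun i =>
    isCompact_Icc.ultrafilter_le_nhds (U.map (m i))
      (le_principal_iff.2 (hmle.mono fun k hk => hk i))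
  choose a ha hma using hlimm
  have hstat : v = ∑ i, a i • gradient (g i) v := by
    have h1 : Tendsto r U (𝓝 (v - ∑ i, a i • gradient (g i) v)) :=
      hv.sub (tendsto_finsetSum _ fun i _ => (hma i).smul
        (((hg i).gradient_one.continuous.tendsto v).comp hv))
    exact sub_eq_zero.1 (tendsto_nhds_unique h1 hr0)
  have : Nonempty (Fin n) := ⟨⟨0, hn⟩⟩
  obtain ⟨j, hj⟩ := Finite.exists_min (fun i => g i v)
  -- The ratio of the `i`-th to the `j`-th coefficient is `exp (-‖θ‖ ^ L (g i u - g j u))`, which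
  -- vanishes in the limit.
  have hcomp : ∀ i, g j v < g i v → a i = 0 := by
    intro i hij
    have hinf : Tendsto (fun k => ‖θ k‖ ^ L * (g i (u k) - g j (u k))) U atTop :=
      ((tendsto_rpow_atTop hL).comp hnorm).atTop_mul_pos (sub_pos.2 hij)
        ((hlimg i).sub (hlimg j))
    have h0 : Tendsto (fun k => m j k * Real.exp (-(‖θ k‖ ^ L * (g i (u k) - g j (u k))))) U
        (𝓝 (a j * 0)) :=
      (hma j).mul (Real.tendsto_exp_neg_atTop_nhds_zero.comp hinf)
    rw [mul_zero] at h0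
    refine tendsto_nhds_unique (hma i) (h0.congr' ?_)
    filter_upwards [hgu] with k hk
    simp only [hm]
    have : Real.exp (-g i (θ k)) = Real.exp (-g j (θ k)) *
        Real.exp (-(‖θ k‖ ^ L * (g i (u k) - g j (u k)))) := by
      rw [← Real.exp_add, hk i, hk j]
      ring_nf
    rw [this]
    ring
  have hq : 0 < g j v := hγ.trans_le (hγv j)
  -- The scale at which the smallest margin is exactly `1`. Gradients scale by `s ^ (L - 1)`, hence
  -- the multipliers `s * a i / s ^ (L - 1)`.
  set s : ℝ := (g j v) ^ (-(1 / L)) with hs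
  have hspos : 0 < s := Real.rpow_pos_of_pos hq _
  have hsL : s ^ L * g j v = 1 := by
    rw [hs, ← Real.rpow_mul hq.le, neg_mul, one_div_mul_cancel hL.ne', Real.rpow_neg_one,
      inv_mul_cancel₀ hq.ne']
  refine ⟨hv1, s, hspos, fun i => ?_, fun i => s * a i / s ^ (L - 1), fun i => ?_, ?_, fun i => ?_⟩
  · rw [hom i s hspos, ← hsL]
    exact mul_le_mul_of_nonneg_left (hj i) (Real.rpow_pos_of_pos hspos L).le
  · exact div_nonneg (mul_nonneg hspos.le (ha i).1) (Real.rpow_pos_of_pos hspos _).le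
  · conv_lhs => rw [hstat, Finset.smul_sum]
    refine Finset.sum_congr rfl fun i _ => ?_
    rw [(hom i).gradient_smul (hd i) hspos, smul_smul, smul_smul,
      div_mul_cancel₀ _ (Real.rpow_pos_of_pos hspos _).ne']
  · rcases (hj i).lt_or_eq with h | h
    · simp [hcomp i h]
    · rw [hom i s hspos, ← h, hsL, sub_self, mul_zero]

end KKT

/-! ### The kernel phase -/

section EarlyPhase

variable {E : Type*} [NormedAddCommGroup E] [InnerProductSpace ℝ E] [CompleteSpace E] {n : ℕ}

/-- Near a common zero at which the gradients have a common ascent direction, the functions `g i`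
are nearly concave as seen from a suitable nearby point, where they are positive. -/
theorem exists_inner_gradient_sub_le (hn : 0 < n) {g : Fin n → E → ℝ}
    (hg : ∀ i, ContDiff ℝ 2 (g i)) {θ₀ h : E} (h0 : ∀ i, g i θ₀ = 0)
    (hh : ∀ i, 0 < inner ℝ (gradient (g i) θ₀) h) :
    ∃ ψ' : E, ∃ b > 0, 0 < ‖θ₀ - ψ'‖ ∧ ∀ ψ, ‖ψ - ψ'‖ ≤ 2 * ‖θ₀ - ψ'‖ →
      ∀ i, inner ℝ (gradient (g i) ψ) (ψ - ψ') ≤ g i ψ - b := by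
  have : Nonempty (Fin n) := ⟨⟨0, hn⟩⟩
  obtain ⟨j, hj⟩ := Finite.exists_min (fun i => inner ℝ (gradient (g i) θ₀) h)
  set β := inner ℝ (gradient (g j) θ₀) h with hβ
  have hβ0 : 0 < β := hh j
  have hh0 : 0 < ‖h‖ := by
    rw [norm_pos_iff]
    rintro rfl
    simp at hβ
    linarith
  -- The two linearizations and the change of gradient cost at most `2 + 1 + 2` times `ε * δ * ‖h‖ =
  -- δ * β / 10`. This uses half of the gain `δ * β`; the other half is `b`.
  set ε : ℝ := β / (10 * ‖h‖) with hε
  have hε0 : 0 < ε := by positivity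
  have hεh : ε * ‖h‖ = β / 10 := by rw [hε]; field_simp
  have hlin : ∀ i, ∀ᶠ q : E × E in 𝓝 (θ₀, θ₀),
      ‖g i q.1 - g i q.2 - inner ℝ (gradient (g i) θ₀) (q.1 - q.2)‖ ≤ ε * ‖q.1 - q.2‖ := by
    intro i
    have hs : HasStrictFDerivAt (g i) (fderiv ℝ (g i) θ₀) θ₀ :=
      (hg i).contDiffAt.hasStrictFDerivAt (by norm_num)
    simpa only [inner_gradient_left] using hs.isLittleO.def hε0
  have hgr : ∀ i, ∀ᶠ q : E × E in 𝓝 (θ₀, θ₀), ‖gradient (g i) q.1 - gradient (g i) θ₀‖ ≤ ε := by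
    intro i
    have hc : Continuous fun q : E × E => ‖gradient (g i) q.1 - gradient (g i) θ₀‖ :=
      (((hg i).gradient_one.continuous.comp continuous_fst).sub continuous_const).norm
    exact (hc.tendsto (θ₀, θ₀)).eventually_le_const (by simpa using hε0)
  obtain ⟨r, hr, hball⟩ := Metric.eventually_nhds_iff_ball.1
    ((eventually_all.2 hlin).and (eventually_all.2 hgr))
  have hball' : ∀ w z, ‖w - θ₀‖ < r → ‖z - θ₀‖ < r → (w, z) ∈ Metric.ball (θ₀, θ₀) r := by
    intro w z hw hz
    rw [Metric.mem_ball, Prod.dist_eq, max_lt_iff, dist_eq_norm, dist_eq_norm]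
    exact ⟨hw, hz⟩
  -- The ball of radius `2 * δ * ‖h‖ = r / 2` about `θ₀ + δ • h` then lies within `3 * r / 4` of
  -- `θ₀`.
  set δ : ℝ := r / (4 * ‖h‖) with hδ
  have hδ0 : 0 < δ := by positivity
  have hδh : δ * ‖h‖ = r / 4 := by rw [hδ]; field_simp
  have hnδ : ‖δ • h‖ = δ * ‖h‖ := by rw [norm_smul, Real.norm_of_nonneg hδ0.le]
  refine ⟨θ₀ + δ • h, δ * β / 2, by positivity, ?_, fun ψ hψ i => ?_⟩
  · rw [sub_add_cancel_left, norm_neg, hnδ]; positivity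
  rw [sub_add_cancel_left, norm_neg, hnδ] at hψ
  have hψ' : ‖θ₀ + δ • h - θ₀‖ < r := by rw [add_sub_cancel_left, hnδ, hδh]; linarith
  have hψ0 : ‖ψ - θ₀‖ < r := by
    have := norm_add_le (ψ - (θ₀ + δ • h)) (δ • h)
    rw [hnδ, show ψ - (θ₀ + δ • h) + δ • h = ψ - θ₀ by abel] at this
    linarith
  have h1 := (abs_le.1 ((hball _ (hball' _ _ hψ0 hψ')).1 i)).1
  have h2 := (abs_le.1 ((hball _ (hball' (θ₀ + δ • h) θ₀ hψ' (by simpa using hr))).1 i)).1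
  have h3 := (hball _ (hball' _ _ hψ0 hψ')).2 i
  have h4 : inner ℝ (gradient (g i) ψ - gradient (g i) θ₀) (ψ - (θ₀ + δ • h)) ≤
      ε * ‖ψ - (θ₀ + δ • h)‖ :=
    (real_inner_le_norm _ _).trans (mul_le_mul_of_nonneg_right h3 (norm_nonneg _))
  rw [inner_sub_left] at h4
  simp only [add_sub_cancel_left, hnδ, h0 i, inner_smul_right] at h1 h2
  have h5 : ε * ‖ψ - (θ₀ + δ • h)‖ ≤ ε * (2 * (δ * ‖h‖)) :=
    mul_le_mul_of_nonneg_left hψ hε0.le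
  have h6 : ε * (δ * ‖h‖) = δ * β / 10 := by rw [← mul_assoc, mul_comm ε δ, mul_assoc, hεh]; ring
  have h7 : δ * β ≤ δ * inner ℝ (gradient (g i) θ₀) h := mul_le_mul_of_nonneg_left (hj i) hδ0.le
  linarith

/-- Half of `B` is spent on `z ≤ exp z` at `z = q - B / 2`, which absorbs large `q`; the other half
keeps a negative multiple of the loss. -/
theorem exp_neg_mul_sub_le (q B : ℝ) :
    Real.exp (-q) * (q - B) ≤ Real.exp (-(B / 2)) - B / 2 * Real.exp (-q) := by
  have h1 : q - B / 2 ≤ Real.exp (q - B / 2) := by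
    linarith [Real.add_one_le_exp (q - B / 2)]
  have h2 : Real.exp (-q) * Real.exp (q - B / 2) = Real.exp (-(B / 2)) := by
    rw [← Real.exp_add]; ring_nf
  have h3 := mul_le_mul_of_nonneg_left h1 (Real.exp_pos (-q)).le
  rw [h2] at h3
  linarith

/-- The rate at which the rescaled flow approaches `ψ'` while it stays where the margins are
nearly concave as seen from `ψ'`. -/
theorem inner_rescaled_velocity_le (hn : 0 < n) {L : ℝ} {g : Fin n → E → ℝ}
    (hom : ∀ i, IsPosHomogeneous L (g i)) (hg : ∀ i, Differentiable ℝ (g i)) {A b lam : ℝ}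
    (hA : 0 < A) {ψ ψ' : E}
    (hψ : ∀ i, inner ℝ (gradient (g i) ψ) (ψ - ψ') ≤ g i ψ - b) :
    inner ℝ (A⁻¹ • (lam • (A • ψ) - gradient (regExpRisk g lam) (A • ψ))) (ψ - ψ') ≤
      (A ^ 2)⁻¹ * (Real.exp (-(b * A ^ L / 2)) - b * A ^ L / 2 * expRisk g (A • ψ)) := by
  have hn' : (n : ℝ) ≠ 0 := by positivity
  have hAL : 0 < A ^ L := Real.rpow_pos_of_pos hA L
  rw [gradient_regExpRisk hg, sub_sub_cancel, inner_smul_left, inner_smul_left, sum_inner,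
    conj_trivial, conj_trivial]
  have hterm : ∀ i, inner ℝ (Real.exp (-g i (A • ψ)) • gradient (g i) (A • ψ)) (ψ - ψ') ≤
      A⁻¹ * (Real.exp (-(b * A ^ L / 2)) - b * A ^ L / 2 * Real.exp (-g i (A • ψ))) := by
    intro i
    rw [(hom i).gradient_smul (hg i) hA, inner_smul_left, inner_smul_left, conj_trivial,
      conj_trivial, Real.rpow_sub_one hA.ne']
    have h1 : g i (A • ψ) = A ^ L * g i ψ := hom i A hA ψ
    have h2 := exp_neg_mul_sub_le (g i (A • ψ)) (b * A ^ L)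
    have h3 : Real.exp (-g i (A • ψ)) * (A ^ L * inner ℝ (gradient (g i) ψ) (ψ - ψ')) ≤
        Real.exp (-g i (A • ψ)) * (g i (A • ψ) - b * A ^ L) := by
      refine mul_le_mul_of_nonneg_left ?_ (Real.exp_pos _).le
      rw [h1]
      have := mul_le_mul_of_nonneg_left (hψ i) hAL.le
      linarith
    have h4 := mul_le_mul_of_nonneg_left (h3.trans h2) (inv_pos.2 hA).le
    refine le_trans (le_of_eq ?_) h4
    field_simp
  calc A⁻¹ * (1 / (n : ℝ) *
        ∑ i, inner ℝ (Real.exp (-g i (A • ψ)) • gradient (g i) (A • ψ)) (ψ - ψ'))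
      ≤ A⁻¹ * (1 / (n : ℝ) * ∑ i, A⁻¹ *
        (Real.exp (-(b * A ^ L / 2)) - b * A ^ L / 2 * Real.exp (-g i (A • ψ)))) := by
        gcongr with i _
        exact hterm i
    _ = _ := by
        rw [← Finset.mul_sum, Finset.sum_sub_distrib, ← Finset.mul_sum, Finset.sum_const,
          Finset.card_univ, Fintype.card_fin, nsmul_eq_mul]
        unfold expRisk
        field_simp

/-- During the kernel phase of the regularized flow from `α • θ₀`, the rescaled flow stays near
`θ₀`, and the regularized risk becomes small before the norm drops to order one. -/
theorem IsGradientFlow.exists_regExpRisk_le (hn : 0 < n) {L : ℝ} (hL : 0 < L)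
    {g : Fin n → E → ℝ} (hom : ∀ i, IsPosHomogeneous L (g i)) (hg : ∀ i, ContDiff ℝ 2 (g i))
    {θ₀ ψ' : E} {b : ℝ} (hb : 0 < b) (hR : 0 < ‖θ₀ - ψ'‖)
    (hψ : ∀ ψ, ‖ψ - ψ'‖ ≤ 2 * ‖θ₀ - ψ'‖ →
      ∀ i, inner ℝ (gradient (g i) ψ) (ψ - ψ') ≤ g i ψ - b)
    {α lam t₁ : ℝ} (hα : 0 < α) (hlam : 0 < lam) (ht₁ : 1 / lam ≤ t₁) {θ : ℝ → E}
    (hθ : IsGradientFlow (regExpRisk g lam) (α • θ₀) θ) {A η : ℝ}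
    (hA : A = α * Real.exp (-(lam * t₁))) (hA1 : 1 ≤ A) (hη : η = Real.exp (-(b * A ^ L / 2)))
    (hηt : 2 * η * t₁ ≤ ‖θ₀ - ψ'‖ ^ 2) :
    ∃ s ∈ Icc 0 t₁, regExpRisk g lam (θ s) ≤
      (Real.exp 1 * A) ^ 2 * (2 / (b * A ^ L)) * (η + 2 * lam * ‖θ₀ - ψ'‖ ^ 2) +
        lam / 2 * (Real.exp 1 * A * (‖ψ'‖ + 2 * ‖θ₀ - ψ'‖)) ^ 2 := by
  have hd : ∀ i, Differentiable ℝ (g i) := fun i => (hg i).differentiable (by norm_num)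
  set R := ‖θ₀ - ψ'‖ with hRdef
  have hη0 : 0 < η := hη ▸ Real.exp_pos _
  set a : ℝ → ℝ := fun t => α * Real.exp (-(lam * t)) with ha
  have ha0 : ∀ t, 0 < a t := fun t => mul_pos hα (Real.exp_pos _)
  have haA : ∀ t, t ≤ t₁ → A ≤ a t := fun t ht => by
    rw [hA]
    exact mul_le_mul_of_nonneg_left
      (Real.exp_le_exp.2 (neg_le_neg (mul_le_mul_of_nonneg_left ht hlam.le))) hα.le
  set ψ : ℝ → E := fun t => (a t)⁻¹ • θ t with hψdef
  have hθψ : ∀ t, θ t = a t • ψ t := fun t => by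
    rw [hψdef, smul_smul, mul_inv_cancel₀ (ha0 t).ne', one_smul]
  have hderiv : ∀ t, 0 ≤ t → HasDerivWithinAt ψ
      ((a t)⁻¹ • (lam • (a t • ψ t) - gradient (regExpRisk g lam) (a t • ψ t))) (Ici 0) t := by
    intro t ht
    have h1 : HasDerivAt a (-lam * a t) t := by
      have := (((hasDerivAt_id t).const_mul lam).neg.exp).const_mul α
      refine this.congr_deriv ?_
      simp only [ha, id_eq, mul_one, Pi.neg_apply]
      ring
    have h2 := (h1.inv (ha0 t).ne').hasDerivWithinAt (s := Ici 0) |>.smul (hθ.2 t ht)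
    refine h2.congr_deriv ?_
    rw [← hθψ t, smul_sub, smul_neg, smul_smul, sub_eq_add_neg, add_comm]
    congr 2
    have := (ha0 t).ne'
    field_simp
  set D : ℝ → ℝ := fun t => 1 / 2 * ‖ψ t - ψ'‖ ^ 2 with hD
  set D' : ℝ → ℝ := fun t => inner ℝ
    ((a t)⁻¹ • (lam • (a t • ψ t) - gradient (regExpRisk g lam) (a t • ψ t))) (ψ t - ψ') with hD'
  have hDderiv : ∀ t, 0 ≤ t → HasDerivWithinAt D (D' t) (Ici 0) t := by
    intro t ht
    have h1 := (((hderiv t ht).sub_const ψ').norm_sq).const_mul (1 / 2)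
    refine h1.congr_deriv ?_
    rw [hD', real_inner_comm]
    ring
  have hDle : ∀ t, t ≤ t₁ → ‖ψ t - ψ'‖ ≤ 2 * R → D' t ≤ ((a t) ^ 2)⁻¹ *
      (Real.exp (-(b * a t ^ L / 2)) - b * a t ^ L / 2 * expRisk g (θ t)) := by
    intro t _ hball
    rw [hθψ t]
    exact inner_rescaled_velocity_le hn hom hd (ha0 t) (hψ _ hball)
  have hexp : ∀ t, t ≤ t₁ → ((a t) ^ 2)⁻¹ * Real.exp (-(b * a t ^ L / 2)) ≤ η := by
    intro t ht
    have h1 : A ^ L ≤ a t ^ L := Real.rpow_le_rpow (by linarith) (haA t ht) hL.le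
    have h2 : ((a t) ^ 2)⁻¹ ≤ 1 := inv_le_one_of_one_le₀
      (one_le_pow₀ (hA1.trans (haA t ht)))
    have h3 : Real.exp (-(b * a t ^ L / 2)) ≤ η := by
      rw [hη]
      have := mul_le_mul_of_nonneg_left h1 hb.le
      exact Real.exp_le_exp.2 (by linarith)
    calc _ ≤ 1 * η := mul_le_mul h2 h3 (Real.exp_pos _).le zero_le_one
      _ = η := one_mul _
  have hψ0 : ψ 0 = θ₀ := by
    simp only [hψdef, ha, hθ.1, mul_zero, neg_zero, Real.exp_zero, mul_one, smul_smul,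
      inv_mul_cancel₀ hα.ne', one_smul]
  have ht₁0 : 0 < t₁ := (by positivity : (0 : ℝ) < 1 / lam).trans_le ht₁
  have hcont : ContinuousOn D (Icc 0 t₁) := fun t ht =>
    ((hDderiv t ht.1).mono Icc_subset_Ici_self).continuousWithinAt
  have hbound : ∀ t, t ∈ Icc 0 t₁ → R ^ 2 / 2 + 2 * η * t ≤ 2 * R ^ 2 := by
    intro t ht
    have : 2 * η * t ≤ 2 * η * t₁ := mul_le_mul_of_nonneg_left ht.2 (by positivity)
    nlinarith
  have hDball : ∀ t, D t ≤ 2 * R ^ 2 → ‖ψ t - ψ'‖ ≤ 2 * R := by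
    intro t ht
    refine abs_le_of_sq_le_sq' ?_ (by positivity) |>.2
    simp only [hD] at ht
    linarith
  -- A barrier argument: the velocity bound is needed only at contact, where `ψ` is still in the
  -- ball. There `D' ≤ η`, and the barrier slope `2 * η` supplies the strict inequality.
  have hbar : ∀ ⦃t⦄, t ∈ Icc 0 t₁ → D t ≤ R ^ 2 / 2 + 2 * η * t := by
    refine image_le_of_deriv_right_lt_deriv_boundary' (f' := D') (B' := fun _ => 2 * η) hcont
      (fun t ht => (hDderiv t ht.1).mono (Ici_subset_Ici.2 ht.1)) ?_ (by fun_prop) ?_ ?_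
    · simp only [hD, hψ0]
      linarith
    · intro t _
      simpa using (((hasDerivAt_id t).const_mul (2 * η)).const_add (R ^ 2 / 2)).hasDerivWithinAt
    · intro t ht heq
      have ht' := Ico_subset_Icc_self ht
      have h1 := hDle t ht.2.le (hDball t (heq.le.trans (hbound t ht')))
      have h2 := hexp t ht.2.le
      have h3 : 0 ≤ ((a t) ^ 2)⁻¹ * (b * a t ^ L / 2 * expRisk g (θ t)) := by
        have := expRisk_nonneg g (θ t)
        have := ha0 t
        positivity
      linarith
  have hball : ∀ t ∈ Icc 0 t₁, ‖ψ t - ψ'‖ ≤ 2 * R := fun t ht =>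
    hDball t ((hbar ht).trans (hbound t ht))
  have hlt : t₁ - 1 / lam < t₁ := by
    have : 0 < 1 / lam := by positivity
    linarith
  have hnn : 0 ≤ t₁ - 1 / lam := by linarith
  -- On this last window of length `1 / lam` the potential drops by at most `2 * R ^ 2`, while the
  -- scale `a` stays within a factor `e` of `A`.
  obtain ⟨s, hs, hslope⟩ := exists_hasDerivAt_eq_slope D D' hlt
    (hcont.mono (Icc_subset_Icc_left hnn))
    (fun t ht => (hDderiv t (hnn.trans ht.1.le)).hasDerivAt (Ici_mem_nhds (hnn.trans_lt ht.1)))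
  have hs0 : 0 ≤ s := hnn.trans hs.1.le
  have hsI : s ∈ Icc 0 t₁ := ⟨hs0, hs.2.le⟩
  have hDs : -(2 * lam * R ^ 2) ≤ D' s := by
    rw [hslope, sub_sub_cancel, div_div_eq_mul_div, div_one]
    have h1 : D (t₁ - 1 / lam) ≤ 2 * R ^ 2 :=
      (hbar ⟨hnn, hlt.le⟩).trans (hbound _ ⟨hnn, hlt.le⟩)
    have h2 : 0 ≤ D t₁ := by simp only [hD]; positivity
    have h3 : -(2 * R ^ 2) * lam ≤ (D t₁ - D (t₁ - 1 / lam)) * lam :=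
      mul_le_mul_of_nonneg_right (by linarith) hlam.le
    linarith
  have hae : a s ≤ Real.exp 1 * A := by
    rw [hA, ha, mul_left_comm, ← Real.exp_add]
    refine mul_le_mul_of_nonneg_left (Real.exp_le_exp.2 ?_) hα.le
    have := mul_le_mul_of_nonneg_left hs.1.le hlam.le
    rw [mul_sub, mul_one_div_cancel hlam.ne'] at this
    linarith
  have hA0 : 0 < A := by linarith
  have hAL : 0 < A ^ L := Real.rpow_pos_of_pos hA0 L
  have hT0 := expRisk_nonneg g (θ s)
  have hT : expRisk g (θ s) ≤
      (Real.exp 1 * A) ^ 2 * (2 / (b * A ^ L)) * (η + 2 * lam * R ^ 2) := by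
    have h1 := hDle s hs.2.le (hball s hsI)
    have h2 := hexp s hs.2.le
    have h3 : ((Real.exp 1 * A) ^ 2)⁻¹ * (b * A ^ L / 2 * expRisk g (θ s)) ≤
        ((a s) ^ 2)⁻¹ * (b * a s ^ L / 2 * expRisk g (θ s)) := by
      have h4 : A ^ L ≤ a s ^ L := Real.rpow_le_rpow hA0.le (haA s hs.2.le) hL.le
      have h5 : ((Real.exp 1 * A) ^ 2)⁻¹ ≤ ((a s) ^ 2)⁻¹ :=
        inv_anti₀ (pow_pos (ha0 s) 2) (pow_le_pow_left₀ (ha0 s).le hae 2)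
      have := ha0 s
      gcongr
    have h6 : ((Real.exp 1 * A) ^ 2)⁻¹ * (b * A ^ L / 2 * expRisk g (θ s)) ≤
        η + 2 * lam * R ^ 2 := by linarith
    calc expRisk g (θ s) = (Real.exp 1 * A) ^ 2 * (2 / (b * A ^ L)) *
          (((Real.exp 1 * A) ^ 2)⁻¹ * (b * A ^ L / 2 * expRisk g (θ s))) := by
          have := Real.exp_pos 1
          field_simp
      _ ≤ _ := mul_le_mul_of_nonneg_left h6 (by positivity)
  have hnorm : ‖θ s‖ ≤ Real.exp 1 * A * (‖ψ'‖ + 2 * R) := by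
    rw [hθψ s, norm_smul, Real.norm_of_nonneg (ha0 s).le]
    have h1 : ‖ψ s‖ ≤ ‖ψ'‖ + 2 * R := by
      have := norm_add_le ψ' (ψ s - ψ')
      rw [add_sub_cancel] at this
      linarith [hball s hsI]
    exact mul_le_mul hae h1 (norm_nonneg _) (by positivity)
  refine ⟨s, hsI, add_le_add hT ?_⟩
  gcongr

end EarlyPhase

/-! ### Asymptotic comparisons -/

section Asymptotics

theorem exists_bounds_of_isTheta_rpow_neg {lam : ℝ → ℝ} {p : ℝ} (hpos : ∀ a, 0 < a → 0 < lam a)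
    (h : Asymptotics.IsTheta atTop lam (fun a : ℝ => a ^ (-p))) :
    ∃ c₁ > 0, ∃ c₂ > 0, ∀ᶠ a in atTop, c₁ * a ^ (-p) ≤ lam a ∧ lam a ≤ c₂ * a ^ (-p) := by
  obtain ⟨C₂, hC₂, h₂⟩ := h.1.exists_pos
  obtain ⟨C₁, hC₁, h₁⟩ := h.2.exists_pos
  refine ⟨C₁⁻¹, inv_pos.2 hC₁, C₂, hC₂, ?_⟩
  filter_upwards [h₁.bound, h₂.bound, eventually_gt_atTop 0] with a h₁ h₂ ha
  rw [Real.norm_of_nonneg (hpos a ha).le, Real.norm_of_nonneg (Real.rpow_nonneg ha.le _)] at h₁ h₂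
  exact ⟨(inv_mul_le_iff₀ hC₁).2 h₁, h₂⟩

theorem eventually_log_le_mul {ε : ℝ} (hε : 0 < ε) : ∀ᶠ a : ℝ in atTop, Real.log a ≤ ε * a := by
  filter_upwards [Real.isLittleO_log_id_atTop.def hε, eventually_gt_atTop 0] with a ha h0
  rw [id, Real.norm_of_nonneg h0.le] at ha
  exact (le_abs_self _).trans ha

theorem eventually_mul_log_rpow_le_rpow (C s : ℝ) {r : ℝ} (hr : 0 < r) :
    ∀ᶠ a : ℝ in atTop, C * Real.log a ^ s ≤ a ^ r := by
  filter_upwards [((isLittleO_log_rpow_rpow_atTop s hr).const_mul_left C).def zero_lt_one,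
    eventually_gt_atTop 0] with a ha h0
  rw [one_mul, Real.norm_of_nonneg (Real.rpow_nonneg h0.le _)] at ha
  exact (le_abs_self _).trans ha

end Asymptotics

/-! ### Quantitative bounds for large initial scale -/

section Phases

variable {E : Type*} [NormedAddCommGroup E] [InnerProductSpace ℝ E] {n : ℕ}

theorem IsPosHomogeneous.exists_le_mul_norm_rpow [FiniteDimensional ℝ E] {L : ℝ} (hL : 0 < L)
    {g : E → ℝ} (hom : IsPosHomogeneous L g) (hg : Continuous g) :
    ∃ F > 0, ∀ θ, g θ ≤ F * ‖θ‖ ^ L := by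
  have : ProperSpace E := FiniteDimensional.proper ℝ E
  obtain ⟨F, hF⟩ := (isCompact_sphere (0 : E) 1).exists_bound_of_continuousOn hg.continuousOn
  refine ⟨max F 1, by positivity, fun θ => ?_⟩
  rcases eq_or_ne θ 0 with rfl | hθ
  · have h := hom 2 two_pos 0
    rw [smul_zero] at h
    have h2 : (1 : ℝ) < 2 ^ L := Real.one_lt_rpow one_lt_two hL
    have : g 0 = 0 := by
      by_contra h0
      exact h2.ne' (mul_right_cancel₀ h0 (by linarith))
    rw [this]
    positivity
  · have hθ' : 0 < ‖θ‖ := norm_pos_iff.2 hθ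
    have h := hom ‖θ‖ hθ' (‖θ‖⁻¹ • θ)
    rw [smul_smul, mul_inv_cancel₀ hθ'.ne', one_smul] at h
    rw [h, mul_comm]
    refine mul_le_mul_of_nonneg_right ?_ (Real.rpow_nonneg hθ'.le L)
    refine (le_abs_self _).trans ((hF _ ?_).trans (le_max_left _ _))
    rw [mem_sphere_zero_iff_norm, norm_smul, norm_inv, norm_norm, inv_mul_cancel₀ hθ'.ne']

/-- If the regularized risk is of order `lam * (log a) ^ (2 / L)`, then all margins and the
`L`-th power of the norm are of order `log a`. -/
theorem eventually_margin_norm_bounds [FiniteDimensional ℝ E] (hn : 0 < n) {L : ℝ} (hL : 0 < L)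
    {g : Fin n → E → ℝ} (hom : ∀ i, IsPosHomogeneous L (g i)) (hg : ∀ i, Continuous (g i))
    {lam : ℝ → ℝ} (hpos : ∀ a, 0 < a → 0 < lam a) {p : ℝ} (hp : 0 < p)
    (hlam : Asymptotics.IsTheta atTop lam (fun a : ℝ => a ^ (-p))) {C : ℝ} (hC : 0 < C) :
    ∃ γ > 0, ∃ β > 0, ∀ᶠ a in atTop, ∀ θ,
      regExpRisk g (lam a) θ ≤ C * lam a * (Real.log a ^ (1 / L)) ^ 2 →
        (∀ i, γ * ‖θ‖ ^ L ≤ g i θ) ∧ β * Real.log a ^ (1 / L) ≤ ‖θ‖ := by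
  obtain ⟨c₁, -, c₂, hc₂, hb⟩ := exists_bounds_of_isTheta_rpow_neg hpos hlam
  obtain ⟨F, hF, hFle⟩ := (hom ⟨0, hn⟩).exists_le_mul_norm_rpow hL (hg _)
  -- Margins exceed `p / 2 * log a`, whereas `‖θ‖ ^ L ≤ √(2 * C) ^ L * log a`; their ratio is the
  -- first constant. The second inverts `g i θ ≤ F * ‖θ‖ ^ L`.
  refine ⟨p / 2 / √(2 * C) ^ L, by positivity, (p / 2 / F) ^ (1 / L), by positivity, ?_⟩
  filter_upwards [hb, eventually_gt_atTop 1,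
    eventually_mul_log_rpow_le_rpow (n * (C * c₂)) (1 / L * 2) (half_pos hp)] with a hab ha hlog θ hθ
  have ha0 : 0 < a := by linarith
  have hΛ : 0 < Real.log a := Real.log_pos ha
  have hla := hpos a ha0
  set M := Real.log a ^ (1 / L) with hM
  have hM0 : 0 < M := Real.rpow_pos_of_pos hΛ _
  have hML : M ^ L = Real.log a := by
    rw [hM, ← Real.rpow_mul hΛ.le, one_div_mul_cancel hL.ne', Real.rpow_one]
  have hM2 : Real.log a ^ (1 / L * 2) = M ^ 2 := by
    rw [hM, Real.rpow_mul hΛ.le, Real.rpow_two]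
  have hT0 := expRisk_nonneg g θ
  have hsq : 0 ≤ lam a / 2 * ‖θ‖ ^ 2 := by positivity
  have hθ' : expRisk g θ + lam a / 2 * ‖θ‖ ^ 2 ≤ C * lam a * M ^ 2 := hθ
  have hq : ∀ i, p / 2 * Real.log a ≤ g i θ := by
    intro i
    have h1 : Real.exp (-g i θ) ≤ Real.exp (-(p / 2 * Real.log a)) := by
      calc Real.exp (-g i θ) ≤ n * expRisk g θ := exp_neg_le_expRisk hn g θ i
        _ ≤ n * (C * lam a * M ^ 2) := by gcongr; linarith
        _ ≤ n * (C * (c₂ * a ^ (-p)) * M ^ 2) := by gcongr; exact hab.2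
        _ = (n * (C * c₂) * M ^ 2) * a ^ (-p) := by ring
        _ ≤ a ^ (p / 2) * a ^ (-p) := by rw [← hM2]; gcongr
        _ = Real.exp (-(p / 2 * Real.log a)) := by
          rw [← Real.rpow_add ha0, Real.rpow_def_of_pos ha0]; ring_nf
    linarith [Real.exp_le_exp.1 h1]
  have hup : ‖θ‖ ^ L ≤ √(2 * C) ^ L * Real.log a := by
    rw [← hML, ← Real.mul_rpow (Real.sqrt_nonneg _) hM0.le]
    refine Real.rpow_le_rpow (norm_nonneg _) ?_ hL.le
    refine (abs_le_of_sq_le_sq' ?_ (by positivity)).2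
    rw [mul_pow, Real.sq_sqrt (by positivity)]
    have h1 : lam a * ‖θ‖ ^ 2 ≤ lam a * (2 * C * M ^ 2) := by linarith
    exact le_of_mul_le_mul_left h1 hla
  refine ⟨fun i => le_trans ?_ (hq i), ?_⟩
  · have : 0 < √(2 * C) ^ L := by positivity
    rw [div_mul_eq_mul_div, div_le_iff₀ this]
    have := mul_le_mul_of_nonneg_left hup (half_pos hp).le
    linarith
  · have h1 := (hq ⟨0, hn⟩).trans (hFle θ)
    have h2 : p / 2 / F * Real.log a ≤ ‖θ‖ ^ L := by
      rw [div_mul_eq_mul_div, div_le_iff₀ hF]; linarith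
    rw [hM, ← Real.mul_rpow (by positivity) hΛ.le]
    calc _ ≤ (‖θ‖ ^ L) ^ (1 / L) := Real.rpow_le_rpow (by positivity) h2 (by positivity)
      _ = ‖θ‖ := by
        rw [← Real.rpow_mul (norm_nonneg _), mul_one_div_cancel hL.ne', Real.rpow_one]

variable [CompleteSpace E]

/-- Before time `log a / lam a` the flow from `a • θ₀` reaches a point whose regularized risk is of
order `lam * (log a) ^ (2 / L)`. -/
theorem eventually_exists_regExpRisk_le (hn : 0 < n) {L : ℝ} (hL : 0 < L)
    {g : Fin n → E → ℝ} (hom : ∀ i, IsPosHomogeneous L (g i)) (hg : ∀ i, ContDiff ℝ 2 (g i))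
    {θ₀ h : E} (h0 : ∀ i, g i θ₀ = 0) (hh : ∀ i, 0 < inner ℝ (gradient (g i) θ₀) h)
    {lam : ℝ → ℝ} (hpos : ∀ a, 0 < a → 0 < lam a) {p : ℝ} (hp : 0 < p)
    (hlam : Asymptotics.IsTheta atTop lam (fun a : ℝ => a ^ (-p))) :
    ∃ C > 0, ∀ᶠ a in atTop, ∀ θ, IsGradientFlow (regExpRisk g (lam a)) (a • θ₀) θ →
      ∃ s ∈ Icc 0 (1 / lam a * Real.log a),
        regExpRisk g (lam a) (θ s) ≤ C * lam a * (Real.log a ^ (1 / L)) ^ 2 := by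
  obtain ⟨ψ', b, hb, hR, hψ⟩ := exists_inner_gradient_sub_le hn hg h0 hh
  obtain ⟨c₁, hc₁, c₂, -, hbd⟩ := exists_bounds_of_isTheta_rpow_neg hpos hlam
  set R := ‖θ₀ - ψ'‖ with hRdef
  -- With `b * A ^ L = N * log a` the error `η` is `a ^ (-p) * a⁻¹`, smaller than `lam a` by a
  -- factor of order `a`, which also beats the duration `t₁`.
  set N : ℝ := 2 * (p + 1) with hN
  have hN0 : 0 < N := by positivity
  set κ : ℝ := (N / b) ^ (1 / L) with hκ
  have hκ0 : 0 < κ := by positivity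
  refine ⟨(Real.exp 1 * κ) ^ 2 * ((1 + 2 * R ^ 2) + (‖ψ'‖ + 2 * R) ^ 2 / 2), by positivity, ?_⟩
  have hlogA : ∀ᶠ a : ℝ in atTop, Real.log (Real.log a) ≤ L / 2 * Real.log a :=
    Real.tendsto_log_atTop.eventually (eventually_log_le_mul (half_pos hL))
  filter_upwards [hbd, eventually_gt_atTop 1, hlogA,
    Real.tendsto_log_atTop.eventually_ge_atTop (2 * (Real.log κ + 1)),
    Real.tendsto_log_atTop.eventually_ge_atTop (b / N),
    Real.tendsto_log_atTop.eventually_ge_atTop (2 / N),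
    eventually_log_le_mul (by positivity : 0 < c₁ * R ^ 2 / 2),
    eventually_ge_atTop c₁⁻¹] with a hab ha hloglog hκΛ hbN hΛN hloga hac θ hθ
  have ha0 : 0 < a := by linarith
  have hΛ : 0 < Real.log a := Real.log_pos ha
  have hla := hpos a ha0
  have hexpΛ : Real.exp (Real.log a) = a := Real.exp_log ha0
  set Λ := Real.log a with hΛdef
  set M := Λ ^ (1 / L) with hM
  have hM0 : 0 < M := Real.rpow_pos_of_pos hΛ _
  have hML : M ^ L = Λ := by
    rw [hM, ← Real.rpow_mul hΛ.le, one_div_mul_cancel hL.ne', Real.rpow_one]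
  have hκL : κ ^ L = N / b := by
    rw [hκ, ← Real.rpow_mul (by positivity), one_div_mul_cancel hL.ne', Real.rpow_one]
  set A := κ * M with hA
  have hA0 : 0 < A := by positivity
  have hAL : b * A ^ L = N * Λ := by
    rw [hA, Real.mul_rpow hκ0.le hM0.le, hML, hκL]; field_simp
  have hA1 : 1 ≤ A := by
    have h1 : 1 ≤ N / b * Λ := by
      rw [div_mul_eq_mul_div, le_div_iff₀ hb]
      rw [div_le_iff₀ hN0] at hbN
      linarith
    rw [hA, hκ, hM, ← Real.mul_rpow (by positivity) hΛ.le]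
    exact Real.one_le_rpow h1 (by positivity)
  have hlogA0 : 0 ≤ Real.log A := Real.log_nonneg hA1
  have hlogA1 : Real.log A + 1 ≤ Λ := by
    rw [hA, Real.log_mul hκ0.ne' hM0.ne', hM, Real.log_rpow hΛ]
    have : 1 / L * Real.log Λ ≤ 1 / L * (L / 2 * Λ) :=
      mul_le_mul_of_nonneg_left hloglog (by positivity)
    have h2 : 1 / L * (L / 2 * Λ) = Λ / 2 := by field_simp
    linarith
  -- The time at which the scale `a * exp (-(lam a * t))` equals `A`; `hlogA1` makes it at least `1
  -- / lam a`.
  set t₁ := (Λ - Real.log A) / lam a with ht₁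
  have ht₁le : t₁ ≤ 1 / lam a * Λ := by
    rw [ht₁, one_div_mul_eq_div]
    gcongr
    linarith
  set η := Real.exp (-(b * A ^ L / 2)) with hη
  have hηa : η = a ^ (-p) * a⁻¹ := by
    rw [hη, hAL, hN, ← Real.rpow_neg_one a, ← Real.rpow_add ha0, Real.rpow_def_of_pos ha0]
    congr 1
    ring
  have hηlam : η ≤ lam a * (c₁⁻¹ * a⁻¹) := by
    rw [hηa]
    have := mul_le_mul_of_nonneg_right hab.1 (by positivity : 0 ≤ c₁⁻¹ * a⁻¹)
    refine le_trans (le_of_eq ?_) this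
    field_simp
  have hca : c₁⁻¹ * a⁻¹ ≤ 1 := by
    rw [← div_eq_mul_inv, div_le_one ha0]; exact hac
  obtain ⟨s, hs, hsle⟩ := hθ.exists_regExpRisk_le hn hL hom hg hb hR hψ ha0 hla (t₁ := t₁) (A := A)
    (by rw [ht₁]; gcongr; linarith)
    (by
      rw [ht₁, mul_div_cancel₀ _ hla.ne', neg_sub, Real.exp_sub, Real.exp_log hA0, hexpΛ]
      field_simp) hA1 hη
    (by
      calc 2 * η * t₁ ≤ 2 * (lam a * (c₁⁻¹ * a⁻¹)) * (1 / lam a * Λ) := by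
            have : 0 ≤ t₁ := div_nonneg (by linarith) hla.le
            gcongr
        _ = 2 * (c₁⁻¹ * a⁻¹) * Λ := by field_simp
        _ ≤ 2 * (c₁⁻¹ * a⁻¹) * (c₁ * R ^ 2 / 2 * a) := by gcongr
        _ = R ^ 2 := by field_simp)
  refine ⟨s, ⟨hs.1, hs.2.trans ht₁le⟩, hsle.trans ?_⟩
  have h1 : η ≤ lam a := hηlam.trans (mul_le_of_le_one_right hla.le hca)
  have h2 : 2 / (b * A ^ L) ≤ 1 := by
    rw [hAL, div_le_one (by positivity)]
    rwa [div_le_iff₀ hN0, mul_comm] at hΛN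
  calc _ ≤ (Real.exp 1 * A) ^ 2 * 1 * (lam a + 2 * lam a * R ^ 2) +
        lam a / 2 * (Real.exp 1 * A * (‖ψ'‖ + 2 * R)) ^ 2 := by gcongr
    _ = _ := by rw [hA]; ring

/-- Shortly after time `log a / lam a` the flow from `a • θ₀` passes through an approximate
stationary point of large norm and well-separated margins. -/
theorem eventually_exists_almost_stationary [FiniteDimensional ℝ E] (hn : 0 < n) {L : ℝ}
    (hL : 0 < L) {g : Fin n → E → ℝ} (hom : ∀ i, IsPosHomogeneous L (g i))
    (hg : ∀ i, ContDiff ℝ 2 (g i)) {θ₀ h : E} (h0 : ∀ i, g i θ₀ = 0)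
    (hh : ∀ i, 0 < inner ℝ (gradient (g i) θ₀) h)
    {lam : ℝ → ℝ} (hpos : ∀ a, 0 < a → 0 < lam a) {p : ℝ} (hp : 0 < p)
    (hlam : Asymptotics.IsTheta atTop lam (fun a : ℝ => a ^ (-p))) {c : ℝ} (hc : 0 < c) :
    ∃ γ > 0, ∃ β > 0, ∃ K, ∀ᶠ a in atTop, ∀ θ,
      IsGradientFlow (regExpRisk g (lam a)) (a • θ₀) θ →
      ∃ t ∈ Icc (1 / lam a * Real.log a) ((1 + c) / lam a * Real.log a),
        (∀ i, γ * ‖θ t‖ ^ L ≤ g i (θ t)) ∧ β * Real.log a ^ (1 / L) ≤ ‖θ t‖ ∧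
        ‖gradient (regExpRisk g (lam a)) (θ t)‖ / (lam a * ‖θ t‖) ≤ √(K / Real.log a) := by
  obtain ⟨C, hC, hearly⟩ := eventually_exists_regExpRisk_le hn hL hom hg h0 hh hpos hp hlam
  obtain ⟨γ, hγ, β, hβ, hbounds⟩ := eventually_margin_norm_bounds hn hL hom
    (fun i => (hg i).continuous) hpos hp hlam hC
  refine ⟨γ, hγ, β, hβ, C / (c * β ^ 2), ?_⟩
  filter_upwards [hearly, hbounds, eventually_gt_atTop 1] with a h1 h2 ha θ hθ
  have hla := hpos a (by linarith)
  have hΛ : 0 < Real.log a := Real.log_pos ha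
  obtain ⟨s, hs, hsle⟩ := h1 θ hθ
  set Λ := Real.log a
  set M := Λ ^ (1 / L) with hM
  have hM0 : 0 < M := Real.rpow_pos_of_pos hΛ _
  have hd := (contDiff_regExpRisk hg (lam a)).differentiable (by norm_num)
  have hanti := hθ.antitoneOn hd
  have hT0 : 0 ≤ 1 / lam a * Λ := by positivity
  have hlen : (1 + c) / lam a * Λ - 1 / lam a * Λ = c * Λ / lam a := by ring
  have hlt : 1 / lam a * Λ < (1 + c) / lam a * Λ := by
    have : 0 < c * Λ / lam a := by positivity
    linarith
  -- Energy at most `C * lam a * M ^ 2` is dissipated over length `c * Λ / lam a`; dividing by `(lam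
  -- a * β * M) ^ 2` leaves order `1 / Λ`.
  obtain ⟨t, ht, hgrad⟩ := hθ.exists_norm_gradient_sq_mul_le hd hT0 hlt
  have hT : regExpRisk g (lam a) (θ (1 / lam a * Λ)) ≤ C * lam a * M ^ 2 :=
    (hanti hs.1 hT0 hs.2).trans hsle
  have htle : regExpRisk g (lam a) (θ t) ≤ C * lam a * M ^ 2 :=
    (hanti hT0 (hT0.trans ht.1.le) ht.1.le).trans hT
  obtain ⟨hm, hnorm⟩ := h2 (θ t) htle
  have hend : 0 ≤ regExpRisk g (lam a) (θ ((1 + c) / lam a * Λ)) := by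
    have := expRisk_nonneg g (θ ((1 + c) / lam a * Λ))
    unfold regExpRisk
    positivity
  refine ⟨t, Ioo_subset_Icc_self ht, hm, hnorm, Real.le_sqrt_of_sq_le ?_⟩
  have hβM : 0 < β * M := by positivity
  rw [hlen] at hgrad
  have hG : ‖gradient (regExpRisk g (lam a)) (θ t)‖ ^ 2 ≤ C / c * lam a ^ 2 * M ^ 2 / Λ := by
    have h3 : ‖gradient (regExpRisk g (lam a)) (θ t)‖ ^ 2 * (c * Λ / lam a) ≤
        C * lam a * M ^ 2 := by linarith
    rw [← le_div_iff₀ (by positivity)] at h3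
    refine h3.trans (le_of_eq ?_)
    field_simp
  calc (‖gradient (regExpRisk g (lam a)) (θ t)‖ / (lam a * ‖θ t‖)) ^ 2
      = ‖gradient (regExpRisk g (lam a)) (θ t)‖ ^ 2 / (lam a * ‖θ t‖) ^ 2 := div_pow _ _ _
    _ ≤ (C / c * lam a ^ 2 * M ^ 2 / Λ) / (lam a * (β * M)) ^ 2 := by gcongr
    _ = C / (c * β ^ 2) / Λ := by field_simp

end Phases

end

/-! ### Assembly of the main theorem -/

theorem mainTheorem2 {X : Type*} {d n : ℕ} (hn : 0 < n)
    (f : EuclideanSpace ℝ (Fin d) → X → ℝ) (L : ℝ)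
    (x : Fin n → X) (y : Fin n → ℝ) (hy : ∀ i, y i = 1 ∨ y i = -1)
    (hf_hom : ∀ (z : X) (c : ℝ), 0 < c → ∀ θ, f (c • θ) z = c ^ L * f θ z)
    (hf_smooth : ∀ z : X, ContDiff ℝ 2 (fun θ => f θ z))
    (θinit : EuclideanSpace ℝ (Fin d)) (hinit : ∀ z : X, f θinit z = 0)
    (hntk : ∃ h : EuclideanSpace ℝ (Fin d),
      ∀ i, 0 < y i * inner ℝ (gradient (fun θ => f θ (x i)) θinit) h)
    (lam : ℝ → ℝ) (hlam_pos : ∀ a : ℝ, 0 < a → 0 < lam a)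
    (p : ℝ) (hp : 0 < p)
    (hlam : Asymptotics.IsTheta Filter.atTop lam (fun a : ℝ => a ^ (-p)))
    (c : ℝ) (hc : 0 < c)
    (α : ℕ → ℝ) (hα : Filter.Tendsto α Filter.atTop Filter.atTop) :
    ∃ t : ℕ → ℝ,
      (∀ k, 1 ≤ α k →
        1 / lam (α k) * Real.log (α k) ≤ t k ∧
          t k ≤ (1 + c) / lam (α k) * Real.log (α k)) ∧
      ∀ v : EuclideanSpace ℝ (Fin d),
        MapClusterPt v Filter.atTop
          (fun k =>
            (‖gradientFlow (regLoss f x y (lam (α k))) (α k • θinit) (t k)‖)⁻¹ •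
              gradientFlow (regLoss f x y (lam (α k))) (α k • θinit) (t k)) →
        ∃ θstar : EuclideanSpace ℝ (Fin d),
          IsMaxMarginKKTPoint f x y θstar ∧ θstar ≠ 0 ∧ v = ‖θstar‖⁻¹ • θstar := by
  obtain ⟨h, hh⟩ := hntk
  set g : Fin n → EuclideanSpace ℝ (Fin d) → ℝ := fun i θ => y i * f θ (x i) with hgdef
  have hreg : ∀ l, regLoss f x y l = regExpRisk g l := fun _ => rfl
  have hgrad : ∀ i θ, gradient (g i) θ = y i • gradient (fun θ => f θ (x i)) θ := by
    intro i θ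
    have := (((hf_smooth (x i)).differentiable (by norm_num)) θ).hasFDerivAt.const_mul (y i)
    rw [gradient, this.fderiv, map_smul, gradient]
  have hom : ∀ i, IsPosHomogeneous L (g i) := fun i =>
    IsPosHomogeneous.const_mul (fun c hc θ => hf_hom (x i) c hc θ) (y i)
  have hg : ∀ i, ContDiff ℝ 2 (g i) := fun i => contDiff_const.mul (hf_smooth (x i))
  have hd : ∀ i, Differentiable ℝ (g i) := fun i => (hg i).differentiable (by norm_num)
  have h0 : ∀ i, g i θinit = 0 := fun i => by simp [hgdef, hinit]
  have hh' : ∀ i, 0 < inner ℝ (gradient (g i) θinit) h := fun i => by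
    rw [hgrad, real_inner_smul_left]; exact hh i
  have hL : 0 < L := by
    by_cases hz : ∃ θ, g ⟨0, hn⟩ θ ≠ 0
    · obtain ⟨θ, hθ⟩ := hz
      exact (hom _).degree_pos (hg _).continuous (h0 _) hθ
    · push Not at hz
      have := hh' ⟨0, hn⟩
      rw [show g ⟨0, hn⟩ = fun _ => 0 from funext hz] at this
      simp at this
  obtain ⟨γ, hγ, β, hβ, K, hlate⟩ :=
    eventually_exists_almost_stationary hn hL hom hg h0 hh' hlam_pos hp hlam hc
  have hflow : ∀ a, 0 < a → IsGradientFlow (regExpRisk g (lam a)) (a • θinit)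
      (gradientFlow (regLoss f x y (lam a)) (a • θinit)) := fun a ha =>
    isGradientFlow_gradientFlow (exists_isGradientFlow_regExpRisk hg (hlam_pos a ha) _)
  have hchoice : ∀ k, ∃ t : ℝ, (1 ≤ α k →
      1 / lam (α k) * Real.log (α k) ≤ t ∧ t ≤ (1 + c) / lam (α k) * Real.log (α k)) ∧
      ((∀ θ, IsGradientFlow (regExpRisk g (lam (α k))) (α k • θinit) θ →
        ∃ t ∈ Set.Icc (1 / lam (α k) * Real.log (α k)) ((1 + c) / lam (α k) * Real.log (α k)),
          (∀ i, γ * ‖θ t‖ ^ L ≤ g i (θ t)) ∧ β * Real.log (α k) ^ (1 / L) ≤ ‖θ t‖ ∧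
          ‖gradient (regExpRisk g (lam (α k))) (θ t)‖ / (lam (α k) * ‖θ t‖) ≤
            √(K / Real.log (α k))) → 0 < α k →
        let w := gradientFlow (regLoss f x y (lam (α k))) (α k • θinit) t
        (∀ i, γ * ‖w‖ ^ L ≤ g i w) ∧ β * Real.log (α k) ^ (1 / L) ≤ ‖w‖ ∧
          ‖gradient (regExpRisk g (lam (α k))) w‖ / (lam (α k) * ‖w‖) ≤
            √(K / Real.log (α k))) := by
    intro k
    by_cases hk : 0 < α k ∧ ∀ θ, IsGradientFlow (regExpRisk g (lam (α k))) (α k • θinit) θ →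
        ∃ t ∈ Set.Icc (1 / lam (α k) * Real.log (α k)) ((1 + c) / lam (α k) * Real.log (α k)),
          (∀ i, γ * ‖θ t‖ ^ L ≤ g i (θ t)) ∧ β * Real.log (α k) ^ (1 / L) ≤ ‖θ t‖ ∧
          ‖gradient (regExpRisk g (lam (α k))) (θ t)‖ / (lam (α k) * ‖θ t‖) ≤
            √(K / Real.log (α k))
    · obtain ⟨t, ht, hw⟩ := hk.2 _ (hflow _ hk.1)
      exact ⟨t, fun _ => ht, fun _ _ => hw⟩
    -- For the remaining `k` the left endpoint serves as a default; eventually none occur, so limit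
    -- points are unaffected.
    · refine ⟨1 / lam (α k) * Real.log (α k), fun h1 => ⟨le_rfl, ?_⟩,
        fun h1 h2 => absurd ⟨h2, h1⟩ hk⟩
      have := hlam_pos _ (zero_lt_one.trans_le h1)
      have := Real.log_nonneg h1
      gcongr
      linarith
  choose t ht hw using hchoice
  refine ⟨t, ht, fun v hv => ?_⟩
  obtain ⟨U, hU, hUv⟩ := mapClusterPt_iff_ultrafilter.1 hv
  have hαU := hα.mono_left hU
  have hgood := ((hαU.eventually hlate).and (hαU.eventually_gt_atTop 0)).mono
    fun k hk => hw k hk.1 hk.2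
  have hlogU := Real.tendsto_log_atTop.comp hαU
  obtain ⟨hv1, s, hs, hfeas, μ, hμ, hstat, hcomp⟩ :=
    exists_kkt_of_tendsto_direction hn hL hom hg U hγ hUv (lam := fun k => lam (α k))
      ((hαU.eventually_gt_atTop 0).mono fun k hk => hlam_pos _ hk)
      (Filter.tendsto_atTop_mono' _ (hgood.mono fun k hk => hk.2.1)
        (((tendsto_rpow_atTop (by positivity : 0 < 1 / L)).comp hlogU).const_mul_atTop hβ))
      (hgood.mono fun k hk => hk.1)
      (squeeze_zero' ((hαU.eventually_gt_atTop 0).mono fun k hk => by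
          have := hlam_pos _ hk
          positivity)
        (hgood.mono fun k hk => hk.2.2)
        (by simpa using (hlogU.const_div_atTop K).sqrt))
  have hsv : ‖s • v‖ = s := by rw [norm_smul, hv1, mul_one, Real.norm_of_nonneg hs.le]
  refine ⟨s • v, ⟨fun i => sub_nonpos.2 (hfeas i), μ, hμ, ?_, fun i => ?_⟩, ?_, ?_⟩
  · have h1 : gradient (fun w : EuclideanSpace ℝ (Fin d) => 1 / 2 * ‖w‖ ^ 2) (s • v) = s • v := by
      -- Half the squared norm is the regularized risk of an empty data set with weight decay `1`,
      -- so the gradient formula applies.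
      have hg0 : (fun w : EuclideanSpace ℝ (Fin d) => 1 / 2 * ‖w‖ ^ 2) =
          regExpRisk (fun (i : Fin 0) _ => (0 : ℝ)) 1 := by
        funext w; simp [regExpRisk, expRisk]
      rw [hg0, gradient_regExpRisk (fun i => i.elim0)]
      simp
    have h2 : ∀ i, gradient (fun w => 1 - y i * f w (x i)) (s • v) = -gradient (g i) (s • v) := by
      intro i
      have := (hd i (s • v)).hasFDerivAt.const_sub 1
      rw [gradient, this.fderiv, map_neg, gradient]
    simp only [h1, h2, smul_neg, Finset.sum_neg_distrib]
    rw [← sub_eq_add_neg, sub_eq_zero]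
    exact hstat
  · linarith [hcomp i]
  · rw [← norm_pos_iff, hsv]; exact hs
  · rw [hsv, smul_smul, inv_mul_cancel₀ hs.ne', one_smul]
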